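/- Let $\lambda_b,\mu_l,\lambda_v>0$. Let $\Phi_b$ be a homogeneous Poisson point process in $\mathbb{R}^2$ with density $\lambda_b$ (the base stations other than the typical one, which is placed at the origin $o$), and let $$V_o=\{y\in\mathbb{R}^2:\ \|y\|\le\|y-x'\|\ \text{ for all } x'\in\Phi_b\cup\{o\}\}$$ be the typical Poisson–Voronoi cell. Let $\{(r_i,\theta_i)\}_i$ be a homogeneous Poisson point process on $(0,\infty)\times[0,2\pi)$ with density $\mu_l/\pi$, and let $L_i=\{(r_i\cos\theta_i-t\sin\theta_i,\ r_i\sin\theta_i+t\cos\theta_i):t\in\mathbb{R}\}$ be the corresponding lines, which form a motion-invariant Poisson line process with line density $\mu_l$. On each line $L_i$ let the users form a homogeneous one-dimensional Poisson point process $\Psi_{L_i}$ with density $\lambda_v$ (with respect to arc length), where $\Phi_b$, the line process and the processes on the different lines are independent; the users on all lines together form the Poisson line Cox process $\Phi_v$. Let $W=\sum_i |L_i\cap V_o|$ be the total chord length of the lines inside $V_o$, let $M=\Phi_v(V_o)$ be the number of users in $V_o$ (the load on the typical base station), and let $\mathcal{L}_W(s)=\mathbb{E}[e^{-sW}]$ be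 the Laplace transform of $W$. Then $W$ and $M$ are almost surely finite random variables, and conditionally on $W$ the load $M$ is Poisson with mean $\lambda_v W$, i.e. for every integer $m\ge 0$, almost surely $$\mathbb{P}(M=m\mid W)=\frac{e^{-\lambda_v W}(\lambda_v W)^m}{m!}.$$ Moreover $\mathcal{L}_W$ is infinitely differentiable on $(0,\infty)$, and for every integer $m\ge 0$ $$\mathbb{P}(M=m)=\frac{(-\lambda_v)^m}{m!}\left[\frac{\partial^m}{\partial s^m}\mathcal{L}_W(s)\right]_{s=\lambda_v}.$$ -/

import Mathlib

open MeasureTheory ProbabilityTheory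

noncomputable section

namespace PLCP

/-- The Euclidean plane. -/
abbrev Plane : Type := EuclideanSpace ℝ (Fin 2)

/-- The number of points of the enumerated point configuration `x 0, x 1, …` that lie in `B`,
counted with multiplicity. -/
def pointCount {E : Type*} (x : ℕ → E) (B : Set E) : ℕ∞ :=
  {i : ℕ | x i ∈ B}.encard

/-- The random points `X 0, X 1, …` form a Poisson point process `∑ i, δ_{X i}` on `E` with
intensity measure `ν`: the number of points in a measurable set of finite intensity is Poisson,
and the numbers of points in pairwise disjoint measurable sets are independent.
(All processes considered here have an infinite intensity measure, hence infinitely many points,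
so that they can be enumerated by `ℕ`. The order of enumeration is arbitrary.) -/
structure IsPoissonPointProcess {Ω E : Type*} [MeasurableSpace Ω] [MeasurableSpace E]
    (X : ℕ → Ω → E) (ν : Measure E) (P : Measure Ω) : Prop where
  measurable : ∀ i, Measurable (X i)
  count_law : ∀ B : Set E, MeasurableSet B → ν B ≠ ⊤ → ∀ k : ℕ,
    P {ω | pointCount (fun i => X i ω) B = (k : ℕ∞)} = poissonMeasure (ν B).toNNReal {k}
  count_indep : ∀ (n : ℕ) (B : Fin n → Set E), (∀ l, MeasurableSet (B l)) →
    Pairwise (fun k l => Disjoint (B k) (B l)) →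
    iIndepFun (fun (l : Fin n) (ω : Ω) => pointCount (fun i => X i ω) (B l)) P

/-- The representation space `(0, ∞) × [0, 2π)` of lines in the plane: `(r, θ)` stands for the line
at distance `r` from the origin whose normal from the origin has direction `θ`. -/
def lineSpace : Set (ℝ × ℝ) := Set.Ioi 0 ×ˢ Set.Ico 0 (2 * Real.pi)

/-- Arc-length parametrization of the line represented by `c = (r, θ)`. -/
def linePoint (c : ℝ × ℝ) (t : ℝ) : Plane :=
  !₂[c.1 * Real.cos c.2 - t * Real.sin c.2, c.1 * Real.sin c.2 + t * Real.cos c.2]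

/-- The line represented by `c = (r, θ)`. -/
def line (c : ℝ × ℝ) : Set Plane := Set.range (linePoint c)

/-- The intensity measure on the representation space of the motion-invariant Poisson line process
with line density `μl` (mean length of lines per unit area): density `μl / π`. -/
def lineIntensity (μl : ℝ) : Measure (ℝ × ℝ) :=
  ENNReal.ofReal (μl / Real.pi) • (volume : Measure (ℝ × ℝ)).restrict lineSpace

/-- The Voronoi cell of the nucleus `x` with respect to the set of nuclei `S`. -/
def voronoiCell (S : Set Plane) (x : Plane) : Set Plane :=
  {y | ∀ x' ∈ S, dist y x ≤ dist y x'}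

/-- The typical cell: the Voronoi cell of the typical base station, placed at the origin, when
`b 0, b 1, …` are the other base stations. -/
def typicalCell (b : ℕ → Plane) : Set Plane :=
  voronoiCell (insert 0 (Set.range b)) 0

/-- The total length, inside the typical cell, of the lines represented by `c 0, c 1, …`. -/
def totalChordLength (b : ℕ → Plane) (c : ℕ → ℝ × ℝ) : ENNReal :=
  ∑' i, Measure.hausdorffMeasure 1 (line (c i) ∩ typicalCell b)

/-- The load on the typical base station: the number of users in the typical cell, where the
`j`-th user on the `i`-th line `c i` has coordinate `t i j` along that line. -/
def load (b : ℕ → Plane) (c : ℕ → ℝ × ℝ) (t : ℕ → ℕ → ℝ) : ℕ∞ :=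
  {p : ℕ × ℕ | linePoint (c p.1) (t p.1 p.2) ∈ typicalCell b}.encard

/-- The Laplace transform `s ↦ E[exp (-s W)]` of a random variable `W`. -/
def laplaceTransform {Ω : Type*} [MeasurableSpace Ω] (W : Ω → ℝ) (P : Measure Ω) (s : ℝ) : ℝ :=
  ∫ ω, Real.exp (-(s * W ω)) ∂P

end PLCP

end

open MeasureTheory ProbabilityTheory
open scoped ENNReal NNReal

namespace PLCP

/-! ### Chords, boundedness of the typical cell, and finite sums over lines -/

section Geometry

/-! Each open quadrant has infinite intensity, so almost surely it contains a base station, and four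
such stations bound the typical cell. Only finitely many lines meet a given disc, so finitely many
chords are nonempty and `W` is finite (`ae_isLocallyFinite`). For such fixed base stations and
lines, the load is a finite sum of independent Poisson counts, one per chord, hence Poisson with
mean `lv * W` (`IsLocallyFinite.hasLaw_load`).

The users are independent of stations and lines, so Fubini gives the joint law of the load and any
event of the latter (`measure_inter_load_eq`). Events of the form `W ∈ B` yield the conditional law,
and the whole space yields `P(M = m) = E[exp (-lv W) (lv W) ^ m / m!]`. Differentiating the Laplace
transform `m` times under the expectation produces the same integral up to the factor `(-lv) ^ m /
m!`. -/

lemma dist_linePoint (c : ℝ × ℝ) (s t : ℝ) : dist (linePoint c s) (linePoint c t) = dist s t := by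
  rw [EuclideanSpace.dist_eq, Real.dist_eq, ← Real.sqrt_sq_eq_abs]
  congr 1
  simp only [Fin.sum_univ_two, linePoint, Real.dist_eq, sq_abs]
  simp
  linear_combination (s - t) ^ 2 * Real.sin_sq_add_cos_sq c.2

lemma norm_linePoint_sq (c : ℝ × ℝ) (t : ℝ) : ‖linePoint c t‖ ^ 2 = c.1 ^ 2 + t ^ 2 := by
  rw [EuclideanSpace.norm_sq_eq]
  simp [Fin.sum_univ_two, linePoint]
  linear_combination (c.1 ^ 2 + t ^ 2) * Real.sin_sq_add_cos_sq c.2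

lemma isometry_linePoint (c : ℝ × ℝ) : Isometry (linePoint c) :=
  Isometry.of_dist_eq (dist_linePoint c)

/-- The coordinates, along the line represented by `c`, of the points of the typical cell. -/
def chord (b : ℕ → Plane) (c : ℝ × ℝ) : Set ℝ := linePoint c ⁻¹' typicalCell b

/-- Arc-length parametrization is an isometry, so it carries Lebesgue measure to length on the line.
-/
lemma hausdorffMeasure_line_inter (b : ℕ → Plane) (c : ℝ × ℝ) :
    Measure.hausdorffMeasure 1 (line c ∩ typicalCell b) = volume (chord b c) := by
  rw [Set.inter_comm, line, ← Set.image_preimage_eq_inter_range,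
    (isometry_linePoint c).hausdorffMeasure_image (Or.inl zero_le_one), hausdorffMeasure_real,
    chord]

lemma totalChordLength_eq (b : ℕ → Plane) (c : ℕ → ℝ × ℝ) :
    totalChordLength b c = ∑' i, volume (chord b (c i)) := by
  simp only [totalChordLength, hausdorffMeasure_line_inter]

lemma mem_typicalCell {b : ℕ → Plane} {y : Plane} :
    y ∈ typicalCell b ↔ ∀ k, dist y 0 ≤ dist y (b k) := by
  simp [typicalCell, voronoiCell]

lemma chord_subset {b : ℕ → Plane} {R : ℝ} (hR : ∀ y ∈ typicalCell b, ‖y‖ ≤ R) (c : ℝ × ℝ) :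
    chord b c ⊆ Set.Icc (-R) R := by
  intro t ht
  have h := hR _ ht
  have h2 := norm_linePoint_sq c t
  have h0 := norm_nonneg (linePoint c t)
  exact abs_le.1 (abs_le_of_sq_le_sq (by nlinarith [sq_nonneg c.1]) (h0.trans h))

lemma abs_fst_le_of_chord_nonempty {b : ℕ → Plane} {R : ℝ} (hR : ∀ y ∈ typicalCell b, ‖y‖ ≤ R)
    {c : ℝ × ℝ} (hc : (chord b c).Nonempty) : |c.1| ≤ R := by
  obtain ⟨t, ht⟩ := hc
  have h := hR _ ht
  have h2 := norm_linePoint_sq c t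
  have h0 := norm_nonneg (linePoint c t)
  exact abs_le_of_sq_le_sq (by nlinarith [sq_nonneg t]) (h0.trans h)

lemma two_mul_inner_le_of_dist_le {y p : Plane} (h : dist y 0 ≤ dist y p) :
    2 * (y 0 * p 0 + y 1 * p 1) ≤ p 0 ^ 2 + p 1 ^ 2 := by
  rw [EuclideanSpace.dist_eq, EuclideanSpace.dist_eq, Real.sqrt_le_sqrt_iff (by positivity)] at h
  simp only [Fin.sum_univ_two, Real.dist_eq, sq_abs] at h
  simp at h
  linarith

/-- A point `y` no farther from the origin than from a point `p` of an open quadrant whose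
closure contains `y` is bounded in terms of `p`. -/
lemma norm_le_of_same_quadrant {y p : Plane} (h : dist y 0 ≤ dist y p)
    (h0 : 0 ≤ y 0 * p 0) (h1 : 0 ≤ y 1 * p 1) (hp0 : p 0 ≠ 0) (hp1 : p 1 ≠ 0) :
    ‖y‖ ≤ (p 0 ^ 2 + p 1 ^ 2) / (2 * |p 0|) + (p 0 ^ 2 + p 1 ^ 2) / (2 * |p 1|) := by
  have hin := two_mul_inner_le_of_dist_le h
  have hn : ‖y‖ ≤ |y 0| + |y 1| := by
    rw [EuclideanSpace.norm_eq]
    refine Real.sqrt_le_iff.2 ⟨by positivity, ?_⟩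
    simp only [Fin.sum_univ_two, Real.norm_eq_abs]
    nlinarith [abs_nonneg (y 0), abs_nonneg (y 1)]
  have e0 : |y 0| * |p 0| = y 0 * p 0 := by rw [← abs_mul, abs_of_nonneg h0]
  have e1 : |y 1| * |p 1| = y 1 * p 1 := by rw [← abs_mul, abs_of_nonneg h1]
  -- Both products in `hin` are nonnegative, so each one alone obeys the bound on their sum.
  have b0 : |y 0| ≤ (p 0 ^ 2 + p 1 ^ 2) / (2 * |p 0|) := by
    rw [le_div_iff₀ (by positivity)]; linarith
  have b1 : |y 1| ≤ (p 0 ^ 2 + p 1 ^ 2) / (2 * |p 1|) := by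
    rw [le_div_iff₀ (by positivity)]; linarith
  linarith

/-- The product of two sets of reals, as a subset of the plane. -/
def planeProd (J K : Set ℝ) : Set Plane := {x | x 0 ∈ J ∧ x 1 ∈ K}

lemma measurableSet_planeProd {J K : Set ℝ} (hJ : MeasurableSet J) (hK : MeasurableSet K) :
    MeasurableSet (planeProd J K) :=
  (measurableSet_preimage (by fun_prop : Measurable fun x : Plane => x 0) hJ).inter
    (measurableSet_preimage (by fun_prop : Measurable fun x : Plane => x 1) hK)

lemma volume_planeProd {J K : Set ℝ} (hJ : MeasurableSet J) (hK : MeasurableSet K) :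
    volume (planeProd J K) = volume J * volume K := by
  rw [← (PiLp.volume_preserving_toLp (Fin 2)).measure_preimage
    (measurableSet_planeProd hJ hK).nullMeasurableSet]
  have : WithLp.toLp 2 ⁻¹' planeProd J K = Set.univ.pi (![J, K] : Fin 2 → Set ℝ) := by
    ext x
    simp [planeProd, Fin.forall_fin_two]
  rw [this, volume_pi_pi]
  simp

/-- If every open quadrant contains a nucleus, then the typical cell is bounded. -/
lemma typicalCell_bounded {b : ℕ → Plane}
    (hpp : ∃ k, b k ∈ planeProd (Set.Ioi 0) (Set.Ioi 0))
    (hpn : ∃ k, b k ∈ planeProd (Set.Ioi 0) (Set.Iio 0))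
    (hnp : ∃ k, b k ∈ planeProd (Set.Iio 0) (Set.Ioi 0))
    (hnn : ∃ k, b k ∈ planeProd (Set.Iio 0) (Set.Iio 0)) :
    ∃ R, ∀ y ∈ typicalCell b, ‖y‖ ≤ R := by
  obtain ⟨i, hi0, hi1⟩ := hpp
  obtain ⟨j, hj0, hj1⟩ := hpn
  obtain ⟨k, hk0, hk1⟩ := hnp
  obtain ⟨l, hl0, hl1⟩ := hnn
  simp only [Set.mem_Ioi, Set.mem_Iio] at *
  -- The bound of `norm_le_of_same_quadrant`; being nonnegative, the four values are all dominated
  -- by their sum.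
  let C : Plane → ℝ := fun p =>
    (p 0 ^ 2 + p 1 ^ 2) / (2 * |p 0|) + (p 0 ^ 2 + p 1 ^ 2) / (2 * |p 1|)
  have hC : ∀ p, 0 ≤ C p := fun p => by positivity
  refine ⟨C (b i) + C (b j) + C (b k) + C (b l), fun y hy => ?_⟩
  rw [mem_typicalCell] at hy
  have hCi := hC (b i)
  have hCj := hC (b j)
  have hCk := hC (b k)
  have hCl := hC (b l)
  rcases le_total 0 (y 0) with h0 | h0 <;> rcases le_total 0 (y 1) with h1 | h1
  · have : ‖y‖ ≤ C (b i) := norm_le_of_same_quadrant (hy i) (mul_nonneg h0 hi0.le)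
      (mul_nonneg h1 hi1.le) hi0.ne' hi1.ne'
    linarith
  · have : ‖y‖ ≤ C (b j) := norm_le_of_same_quadrant (hy j) (mul_nonneg h0 hj0.le)
      (mul_nonneg_of_nonpos_of_nonpos h1 hj1.le) hj0.ne' hj1.ne
    linarith
  · have : ‖y‖ ≤ C (b k) := norm_le_of_same_quadrant (hy k)
      (mul_nonneg_of_nonpos_of_nonpos h0 hk0.le) (mul_nonneg h1 hk1.le) hk0.ne hk1.ne'
    linarith
  · have : ‖y‖ ≤ C (b l) := norm_le_of_same_quadrant (hy l)
      (mul_nonneg_of_nonpos_of_nonpos h0 hl0.le) (mul_nonneg_of_nonpos_of_nonpos h1 hl1.le)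
      hl0.ne hl1.ne
    linarith

/-- The nuclei `b` and lines `c` are such that the typical cell is bounded and only finitely many
lines hit any given disc around the origin. -/
def IsLocallyFinite (b : ℕ → Plane) (c : ℕ → ℝ × ℝ) : Prop :=
  (∃ R, ∀ y ∈ typicalCell b, ‖y‖ ≤ R) ∧ ∀ n : ℕ, {i | |(c i).1| ≤ n}.Finite

lemma IsLocallyFinite.finite_chord_nonempty {b : ℕ → Plane} {c : ℕ → ℝ × ℝ}
    (h : IsLocallyFinite b c) : {i | (chord b (c i)).Nonempty}.Finite := by
  obtain ⟨⟨R, hR⟩, hc⟩ := h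
  obtain ⟨n, hn⟩ := exists_nat_ge R
  exact (hc n).subset fun i hi => (abs_fst_le_of_chord_nonempty hR hi).trans hn

lemma IsLocallyFinite.volume_chord_ne_top {b : ℕ → Plane} {c : ℕ → ℝ × ℝ}
    (h : IsLocallyFinite b c) (i : ℕ) : volume (chord b (c i)) ≠ ⊤ := by
  obtain ⟨⟨R, hR⟩, -⟩ := h
  exact measure_ne_top_of_subset (chord_subset hR _) (by simp)

lemma IsLocallyFinite.totalChordLength_eq_sum {b : ℕ → Plane} {c : ℕ → ℝ × ℝ}
    (h : IsLocallyFinite b c) :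
    totalChordLength b c = ∑ i ∈ h.finite_chord_nonempty.toFinset, volume (chord b (c i)) := by
  rw [totalChordLength_eq]
  refine tsum_eq_sum fun i hi => ?_
  have : chord b (c i) = ∅ := by simpa [Set.not_nonempty_iff_eq_empty] using hi
  simp [this]

lemma IsLocallyFinite.totalChordLength_ne_top {b : ℕ → Plane} {c : ℕ → ℝ × ℝ}
    (h : IsLocallyFinite b c) : totalChordLength b c ≠ ⊤ := by
  rw [h.totalChordLength_eq_sum]
  exact (ENNReal.sum_lt_top.2 fun i _ => (h.volume_chord_ne_top i).lt_top).ne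

lemma encard_setOf_prod_mem_eq_sum {α β : Type*} (S : Set (α × β)) (F : Finset α)
    (hF : ∀ p ∈ S, p.1 ∈ F) : S.encard = ∑ i ∈ F, {j | (i, j) ∈ S}.encard := by
  classical
  have hS : S = ⋃ i ∈ F, Prod.mk i '' {j | (i, j) ∈ S} := by
    ext ⟨i, j⟩
    simp only [Set.mem_iUnion, Set.mem_image, Set.mem_ofPred_eq, Prod.mk.injEq, exists_prop]
    exact ⟨fun h => ⟨i, hF _ h, j, h, rfl, rfl⟩, by rintro ⟨_, _, _, h, rfl, rfl⟩; exact h⟩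
  conv_lhs => rw [hS]
  clear hS hF
  induction F using Finset.induction_on with
  | empty => simp
  | insert a F ha ih =>
    rw [Finset.set_biUnion_insert, Set.encard_union_eq, ih, Finset.sum_insert ha,
      (Prod.mk_right_injective a).encard_image]
    rw [Set.disjoint_left]
    rintro _ ⟨j, hj, rfl⟩ h
    simp only [Set.mem_iUnion, Set.mem_image, Set.mem_ofPred_eq, Prod.mk.injEq, exists_prop] at h
    obtain ⟨i, hi, _, _, rfl, _⟩ := h
    exact ha hi

lemma IsLocallyFinite.load_eq_sum {b : ℕ → Plane} {c : ℕ → ℝ × ℝ} (h : IsLocallyFinite b c)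
    (t : ℕ → ℕ → ℝ) :
    load b c t = ∑ i ∈ h.finite_chord_nonempty.toFinset, pointCount (t i) (chord b (c i)) := by
  refine encard_setOf_prod_mem_eq_sum _ _ fun p hp => ?_
  simp only [Set.Finite.mem_toFinset, Set.mem_ofPred_eq]
  exact ⟨t p.1 p.2, hp⟩

end Geometry

/-! ### Joint measurability of chord length and load -/

section Measurability

variable {α : Type*} [MeasurableSpace α]

lemma measurable_encard_setOf {ι : Type*} [Countable ι] {p : α → ι → Prop}
    (hp : ∀ i, MeasurableSet {x | p x i}) : Measurable fun x => {i | p x i}.encard :=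
  measurable_encard.comp (measurable_set_iff.2 fun i => measurableSet_setOfPred.1 (hp i))

lemma measurable_linePoint : Measurable fun q : (ℝ × ℝ) × ℝ => linePoint q.1 q.2 := by
  unfold linePoint
  fun_prop

lemma measurableSet_linePoint_mem_typicalCell {b : α → ℕ → Plane} {c : α → ℝ × ℝ} {t : α → ℝ}
    (hb : Measurable b) (hc : Measurable c) (ht : Measurable t) :
    MeasurableSet {x | linePoint (c x) (t x) ∈ typicalCell (b x)} := by
  have hl : Measurable fun x => linePoint (c x) (t x) :=
    measurable_linePoint.comp (hc.prodMk ht)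
  simp only [mem_typicalCell, Set.ofPred_forall]
  refine MeasurableSet.iInter fun k => measurableSet_le (hl.dist measurable_const) (hl.dist ?_)
  fun_prop

lemma measurableSet_chord (b : ℕ → Plane) (c : ℝ × ℝ) : MeasurableSet (chord b c) :=
  measurableSet_linePoint_mem_typicalCell measurable_const measurable_const measurable_id

/-- Chord lengths are measures of sections of a jointly measurable set. -/
lemma measurable_totalChordLength {b : α → ℕ → Plane} {c : α → ℕ → ℝ × ℝ} (hb : Measurable b)
    (hc : Measurable c) : Measurable fun x => totalChordLength (b x) (c x) := by
  simp only [totalChordLength_eq]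
  refine Measurable.tsum fun i => ?_
  exact measurable_measure_prodMk_left (measurableSet_linePoint_mem_typicalCell
    (α := α × ℝ) (b := fun x => b x.1) (c := fun x => c x.1 i) (t := fun x => x.2) (by fun_prop) (by fun_prop) (by fun_prop))

lemma measurable_load {b : α → ℕ → Plane} {c : α → ℕ → ℝ × ℝ} {t : α → ℕ → ℕ → ℝ}
    (hb : Measurable b) (hc : Measurable c) (ht : Measurable t) :
    Measurable fun x => load (b x) (c x) (t x) :=
  measurable_encard_setOf fun _ => measurableSet_linePoint_mem_typicalCell
    (by fun_prop) (by fun_prop) (by fun_prop)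

lemma measurable_pointCount {E : Type*} [MeasurableSpace E] {B : Set E} (hB : MeasurableSet B) :
    Measurable fun x : ℕ → E => pointCount x B :=
  measurable_encard_setOf fun i => measurable_pi_apply i hB

end Measurability

/-! ### Poisson counts with values in `ℕ∞` -/

section Poisson

variable {Ω E : Type*} [MeasurableSpace Ω] [MeasurableSpace E] {P : Measure Ω}
  {X : ℕ → Ω → E} {ν : Measure E}

lemma IsPoissonPointProcess.measurable_count (hX : IsPoissonPointProcess X ν P) {B : Set E}
    (hB : MeasurableSet B) : Measurable fun ω => pointCount (fun i => X i ω) B :=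
  (measurable_pointCount hB).comp (measurable_pi_lambda _ hX.measurable)

/-- `count_law` covers only finite intensity. By σ-finiteness, `B` contains sets of finite intensity
above any `n`, each empty with probability at most `exp (-n)`. -/
lemma IsPoissonPointProcess.ae_exists_mem [SigmaFinite ν] (hX : IsPoissonPointProcess X ν P)
    {B : Set E} (hB : MeasurableSet B) (hν : ν B = ⊤) : ∀ᵐ ω ∂P, ∃ i, X i ω ∈ B := by
  rw [ae_iff]
  have hle : ∀ n : ℕ, P {ω | ¬ ∃ i, X i ω ∈ B} ≤ ENNReal.ofReal (Real.exp (-n)) := by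
    intro n
    obtain ⟨A, hA, hAB, hnA, hAt⟩ := Measure.exists_subset_measure_lt_top (μ := ν) hB
      (r := (n : ℝ≥0∞)) (by simp [hν])
    calc P {ω | ¬ ∃ i, X i ω ∈ B}
        ≤ P {ω | pointCount (fun i => X i ω) A = ((0 : ℕ) : ℕ∞)} := by
          refine measure_mono fun ω hω => ?_
          simp only [Set.mem_ofPred_eq, not_exists] at hω
          simp only [pointCount, Set.mem_ofPred_eq, Nat.cast_zero, Set.encard_eq_zero]
          exact Set.eq_empty_of_forall_notMem fun i hi => hω i (hAB hi)
      _ = ENNReal.ofReal (Real.exp (-(ν A).toNNReal)) := by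
          rw [hX.count_law A hA hAt.ne, poissonMeasure_singleton]
          simp
      _ ≤ _ := by
          refine ENNReal.ofReal_le_ofReal (Real.exp_le_exp.2 (neg_le_neg ?_))
          have : (n : ℝ≥0∞).toReal ≤ (ν A).toReal := ENNReal.toReal_mono hAt.ne hnA.le
          rwa [ENNReal.toReal_natCast] at this
  refine le_antisymm (ge_of_tendsto' (x := Filter.atTop) ?_ hle) zero_le
  have : Filter.Tendsto (fun n : ℕ => Real.exp (-n)) Filter.atTop (nhds 0) :=
    Real.tendsto_exp_neg_atTop_nhds_zero.comp tendsto_natCast_atTop_atTop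
  simpa using ENNReal.tendsto_ofReal this

variable [IsProbabilityMeasure P]

/-- The Poisson weights already sum to one, leaving no mass for `⊤`. -/
lemma ae_exists_eq_natCast_of_poisson {N : Ω → ℕ∞} (hN : Measurable N) {r : ℝ≥0}
    (h : ∀ k : ℕ, P {ω | N ω = k} = poissonMeasure r {k}) : ∀ᵐ ω ∂P, ∃ k : ℕ, N ω = k := by
  have hm : ∀ k : ℕ, MeasurableSet {ω | N ω = k} := fun k => hN (measurableSet_singleton _)
  have hU : P (⋃ k : ℕ, {ω | N ω = k}) = 1 := by
    rw [measure_iUnion _ hm]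
    · simp only [h]
      have := measure_iUnion (μ := poissonMeasure r) (f := fun k : ℕ => {k})
        (fun i j hij => by simpa using hij) fun _ => measurableSet_singleton _
      rw [← this, Set.iUnion_of_singleton, measure_univ]
    · intro i j hij
      simp only [Function.onFun, Set.disjoint_left, Set.mem_ofPred_eq]
      intro ω h1 h2
      exact hij (by exact_mod_cast h1.symm.trans h2)
  have := (mem_ae_iff_prob_eq_one (MeasurableSet.iUnion hm)).2 hU
  filter_upwards [this] with ω hω
  simpa using hω

lemma hasLaw_poisson_of_singleton {N : Ω → ℕ∞} (hN : Measurable N) {r : ℝ≥0}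
    (h : ∀ k : ℕ, P {ω | N ω = k} = poissonMeasure r {k}) :
    HasLaw N ((poissonMeasure r).map (Nat.cast : ℕ → ℕ∞)) P where
  aemeasurable := hN.aemeasurable
  map_eq := by
    refine Measure.ext_of_singleton fun a => ?_
    rw [Measure.map_apply hN (measurableSet_singleton _),
      Measure.map_apply .of_discrete (measurableSet_singleton _)]
    induction a using ENat.recTopCoe with
    | top =>
      have h1 : (Nat.cast : ℕ → ℕ∞) ⁻¹' {⊤} = ∅ := by ext; simp
      rw [h1, measure_empty]
      refine measure_mono_null (fun ω (hω : N ω = ⊤) => ?_)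
        (ae_iff.1 (ae_exists_eq_natCast_of_poisson hN h))
      simp [hω]
    | coe k =>
      have h1 : (Nat.cast : ℕ → ℕ∞) ⁻¹' {(k : ℕ∞)} = {k} := by ext; simp
      rw [h1, ← h k]
      rfl

lemma IsPoissonPointProcess.hasLaw_count (hX : IsPoissonPointProcess X ν P) {B : Set E}
    (hB : MeasurableSet B) (hν : ν B ≠ ⊤) :
    HasLaw (fun ω => pointCount (fun i => X i ω) B)
      ((poissonMeasure (ν B).toNNReal).map (Nat.cast : ℕ → ℕ∞)) P :=
  hasLaw_poisson_of_singleton (hX.measurable_count hB) (hX.count_law B hB hν)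

lemma IsPoissonPointProcess.ae_finite (hX : IsPoissonPointProcess X ν P) {B : Set E}
    (hB : MeasurableSet B) (hν : ν B ≠ ⊤) : ∀ᵐ ω ∂P, {i | X i ω ∈ B}.Finite := by
  filter_upwards [ae_exists_eq_natCast_of_poisson (hX.measurable_count hB)
    (hX.count_law B hB hν)] with ω ⟨k, hk⟩
  exact Set.finite_of_encard_eq_coe hk

lemma hasLaw_sum_poisson {ι : Type*} {N : ι → Ω → ℕ∞} (hN : ∀ i, Measurable (N i))
    (hind : iIndepFun N P) {r : ι → ℝ≥0}
    (hlaw : ∀ i, HasLaw (N i) ((poissonMeasure (r i)).map (Nat.cast : ℕ → ℕ∞)) P)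
    (F : Finset ι) :
    HasLaw (∑ i ∈ F, N i) ((poissonMeasure (∑ i ∈ F, r i)).map (Nat.cast : ℕ → ℕ∞)) P := by
  classical
  induction F using Finset.induction_on with
  | empty =>
    refine hasLaw_poisson_of_singleton (by rw [Finset.sum_empty]; exact measurable_const) fun k => ?_
    rcases Nat.eq_zero_or_pos k with rfl | hk
    · simp [poissonMeasure_singleton]
    · have : (0 : ℕ∞) ≠ k := by exact_mod_cast hk.ne
      simp [poissonMeasure_singleton, this, hk.ne']
  | insert a F ha ih =>
    rw [Finset.sum_insert ha, Finset.sum_insert ha]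
    exact (hind.indepFun_finsetSum_of_notMem hN ha).symm.hasLaw_add_map_cast_poissonMeasure
      (hlaw a) ih

end Poisson

/-! ### Conditioning on base stations and lines -/

section Model

variable {Ω : Type*} [MeasurableSpace Ω] {P : Measure Ω} [IsProbabilityMeasure P]

/-- Angles lie in a bounded interval, so bounding the distance leaves a bounded rectangle. -/
lemma lineIntensity_abs_fst_le_ne_top (μl R : ℝ) :
    lineIntensity μl {c : ℝ × ℝ | |c.1| ≤ R} ≠ ⊤ := by
  have hm : MeasurableSet {c : ℝ × ℝ | |c.1| ≤ R} := measurableSet_le (by fun_prop) (by fun_prop)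
  rw [lineIntensity, Measure.smul_apply, Measure.restrict_apply hm, smul_eq_mul]
  refine ENNReal.mul_ne_top ENNReal.ofReal_ne_top ?_
  refine measure_ne_top_of_subset (s := Set.Icc (-R) R ×ˢ Set.Ico 0 (2 * Real.pi))
    ?_ ?_
  · intro c hc
    exact Set.mem_prod.2 ⟨abs_le.1 hc.1, hc.2.2⟩
  rw [Measure.volume_eq_prod, Measure.prod_prod]
  simp only [Real.volume_Icc, Real.volume_Ico]
  exact ENNReal.mul_ne_top ENNReal.ofReal_ne_top ENNReal.ofReal_ne_top

lemma ae_isLocallyFinite {lb μl : ℝ} (hlb : 0 < lb) {b : ℕ → Ω → Plane} {c : ℕ → Ω → ℝ × ℝ}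
    (hb : IsPoissonPointProcess b (ENNReal.ofReal lb • (volume : Measure Plane)) P)
    (hc : IsPoissonPointProcess c (lineIntensity μl) P) :
    ∀ᵐ ω ∂P, IsLocallyFinite (fun i => b i ω) (fun i => c i ω) := by
  have hfin : ∀ᵐ ω ∂P, ∀ n : ℕ, {i | |(c i ω).1| ≤ n}.Finite :=
    ae_all_iff.2 fun n => hc.ae_finite (B := {c | |c.1| ≤ n})
      (measurableSet_le (by fun_prop) (by fun_prop)) (lineIntensity_abs_fst_le_ne_top μl n)
  have : SigmaFinite (ENNReal.ofReal lb • (volume : Measure Plane)) :=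
    MeasureTheory.SMul.sigmaFinite lb.toNNReal
  have hquad : ∀ {J K : Set ℝ}, MeasurableSet J → MeasurableSet K → volume J = ⊤ → volume K = ⊤ →
      ∀ᵐ ω ∂P, ∃ k, b k ω ∈ planeProd J K := fun hJ hK hJt hKt =>
    hb.ae_exists_mem (measurableSet_planeProd hJ hK) (by
      rw [Measure.smul_apply, volume_planeProd hJ hK, hJt, hKt, smul_eq_mul, ENNReal.top_mul_top,
        ENNReal.mul_top (by simpa using hlb)])
  filter_upwards [hfin,
    hquad measurableSet_Ioi measurableSet_Ioi Real.volume_Ioi Real.volume_Ioi,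
    hquad measurableSet_Ioi measurableSet_Iio Real.volume_Ioi Real.volume_Iio,
    hquad measurableSet_Iio measurableSet_Ioi Real.volume_Iio Real.volume_Ioi,
    hquad measurableSet_Iio measurableSet_Iio Real.volume_Iio Real.volume_Iio]
    with ω h hpp hpn hnp hnn
  exact ⟨typicalCell_bounded hpp hpn hnp hnn, h⟩

/-- For fixed base stations and lines, the load is Poisson. -/
lemma IsLocallyFinite.hasLaw_load {lv : ℝ} {T : ℕ → ℕ → Ω → ℝ}
    (hT : ∀ i, IsPoissonPointProcess (T i) (ENNReal.ofReal lv • (volume : Measure ℝ)) P)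
    (hTT : iIndepFun (fun (i : ℕ) (ω : Ω) (j : ℕ) => T i j ω) P)
    {b : ℕ → Plane} {c : ℕ → ℝ × ℝ} (h : IsLocallyFinite b c) :
    HasLaw (fun ω => load b c fun i j => T i j ω)
      ((poissonMeasure (ENNReal.ofReal lv * totalChordLength b c).toNNReal).map
        (Nat.cast : ℕ → ℕ∞)) P := by
  have hν : ∀ i, (ENNReal.ofReal lv • (volume : Measure ℝ)) (chord b (c i)) ≠ ⊤ := fun i =>
    ENNReal.mul_ne_top ENNReal.ofReal_ne_top (h.volume_chord_ne_top i)
  have key := hasLaw_sum_poisson (P := P)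
    (N := fun i ω => pointCount (fun j => T i j ω) (chord b (c i)))
    (fun i => (hT i).measurable_count (measurableSet_chord _ _))
    (hTT.comp (fun i x => pointCount x (chord b (c i)))
      fun i => measurable_pointCount (measurableSet_chord _ _))
    (fun i => (hT i).hasLaw_count (measurableSet_chord _ _) (hν i))
    h.finite_chord_nonempty.toFinset
  rw [← ENNReal.toNNReal_sum fun i _ => hν i] at key
  simp only [Measure.smul_apply, smul_eq_mul, ← Finset.mul_sum,
    ← h.totalChordLength_eq_sum] at key
  convert key using 2 with ω
  rw [h.load_eq_sum, Finset.sum_apply]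

/-- Independence makes the joint law a product, and Fubini integrates the Poisson law found for
fixed stations and lines. The value `a = ⊤` is allowed and later shows that the load is finite. -/
lemma measure_inter_load_eq {lb μl lv : ℝ} (hlb : 0 < lb)
    {b : ℕ → Ω → Plane} {c : ℕ → Ω → ℝ × ℝ} {T : ℕ → ℕ → Ω → ℝ}
    (hb : IsPoissonPointProcess b (ENNReal.ofReal lb • (volume : Measure Plane)) P)
    (hc : IsPoissonPointProcess c (lineIntensity μl) P)
    (hT : ∀ i, IsPoissonPointProcess (T i) (ENNReal.ofReal lv • (volume : Measure ℝ)) P)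
    (hTT : iIndepFun (fun (i : ℕ) (ω : Ω) (j : ℕ) => T i j ω) P)
    (hbcT : IndepFun (fun ω => ((fun i => b i ω), (fun i => c i ω))) (fun ω i j => T i j ω) P)
    {A : Set ((ℕ → Plane) × (ℕ → ℝ × ℝ))} (hA : MeasurableSet A) (a : ℕ∞) :
    P ({ω | load (fun i => b i ω) (fun i => c i ω) (fun i j => T i j ω) = a} ∩
        {ω | ((fun i => b i ω), (fun i => c i ω)) ∈ A}) =
      ∫⁻ ω in {ω | ((fun i => b i ω), (fun i => c i ω)) ∈ A},
        (poissonMeasure (ENNReal.ofReal lv *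
          totalChordLength (fun i => b i ω) (fun i => c i ω)).toNNReal).map
            (Nat.cast : ℕ → ℕ∞) {a} ∂P := by
  set Y : Ω → (ℕ → Plane) × (ℕ → ℝ × ℝ) := fun ω => ((fun i => b i ω), (fun i => c i ω)) with hY
  set Z : Ω → ℕ → ℕ → ℝ := fun ω i j => T i j ω with hZ
  have hYm : Measurable Y :=
    (measurable_pi_lambda _ hb.measurable).prodMk (measurable_pi_lambda _ hc.measurable)
  have hZm : Measurable Z :=
    measurable_pi_lambda _ fun i => measurable_pi_lambda _ fun j => (hT i).measurable j
  let S : Set (((ℕ → Plane) × (ℕ → ℝ × ℝ)) × (ℕ → ℕ → ℝ)) := {x | load x.1.1 x.1.2 x.2 = a}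
  have hS : MeasurableSet S :=
    measurable_load measurable_fst.fst measurable_fst.snd measurable_snd (measurableSet_singleton a)
  have hprod := (indepFun_iff_map_prod_eq_prod_map_map hYm.aemeasurable hZm.aemeasurable).1 hbcT
  have hSA : MeasurableSet (S ∩ A ×ˢ Set.univ) := hS.inter (hA.prod .univ)
  have h1 : P ({ω | load (fun i => b i ω) (fun i => c i ω) (fun i j => T i j ω) = a} ∩
      {ω | Y ω ∈ A}) = (P.map Y).prod (P.map Z) (S ∩ A ×ˢ Set.univ) := by
    rw [← hprod, Measure.map_apply (hYm.prodMk hZm) hSA]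
    congr 1
    ext ω
    simp [S, Y, Z]
  have := Measure.isProbabilityMeasure_map (μ := P) hZm.aemeasurable
  rw [h1, Measure.prod_apply hSA, lintegral_map (measurable_measure_prodMk_left hSA) hYm,
    ← lintegral_indicator (show MeasurableSet {ω | Y ω ∈ A} from hYm hA)]
  refine lintegral_congr_ae ?_
  filter_upwards [ae_isLocallyFinite hlb hb hc] with ω hω
  by_cases hωA : Y ω ∈ A
  · have hpre : Prod.mk (Y ω) ⁻¹' (S ∩ A ×ˢ Set.univ) = {t | load (Y ω).1 (Y ω).2 t = a} := by
      ext t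
      simp [S, hωA]
    have hm : MeasurableSet {t | load (Y ω).1 (Y ω).2 t = a} :=
      measurable_load measurable_const measurable_const measurable_id (measurableSet_singleton a)
    rw [hpre, Measure.map_apply hZm hm, Set.indicator_of_mem (by exact hωA),
      ← (hω.hasLaw_load hT hTT).map_eq, Measure.map_apply _ (measurableSet_singleton a)]
    · rfl
    · exact measurable_load measurable_const measurable_const hZm
  · rw [Set.indicator_of_notMem (by exact hωA)]
    simp [hωA]

end Model

/-! ### The Laplace transform as a reflected moment generating function -/

section Laplace

variable {Ω : Type*} [MeasurableSpace Ω] {P : Measure Ω} {X : Ω → ℝ}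

lemma laplaceTransform_eq_mgf_neg (X : Ω → ℝ) (P : Measure Ω) :
    laplaceTransform X P = fun s => mgf X P (-s) := by
  ext s
  simp [laplaceTransform, mgf]

/-- For `t < 0` and `X ≥ 0` the exponential is at most one, and the half-line is open. -/
lemma Iio_subset_interior_integrableExpSet [IsFiniteMeasure P] (hX : AEMeasurable X P)
    (h0 : 0 ≤ X) : Set.Iio 0 ⊆ interior (integrableExpSet X P) := by
  refine interior_maximal (fun t ht => ?_) isOpen_Iio
  refine Integrable.of_bound (C := 1) (by fun_prop) (ae_of_all _ fun ω => ?_)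
  rw [Real.norm_eq_abs, Real.abs_exp, Real.exp_le_one_iff]
  exact mul_nonpos_of_nonpos_of_nonneg (le_of_lt ht) (h0 ω)

lemma contDiffOn_laplaceTransform [IsFiniteMeasure P] (hX : AEMeasurable X P) (h0 : 0 ≤ X)
    (n : WithTop ℕ∞) : ContDiffOn ℝ n (laplaceTransform X P) (Set.Ioi 0) := by
  rw [laplaceTransform_eq_mgf_neg]
  intro s hs
  have : AnalyticAt ℝ (mgf X P) (-s) :=
    analyticAt_mgf (Iio_subset_interior_integrableExpSet hX h0 (Set.mem_Iio.2 (neg_lt_zero.2 hs)))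
  exact (this.contDiffAt.comp s contDiffAt_id.neg).contDiffWithinAt

lemma iteratedDeriv_laplaceTransform [IsFiniteMeasure P] (hX : AEMeasurable X P) (h0 : 0 ≤ X)
    {s : ℝ} (hs : 0 < s) (m : ℕ) :
    iteratedDeriv m (laplaceTransform X P) s =
      (-1) ^ m * ∫ ω, X ω ^ m * Real.exp (-(s * X ω)) ∂P := by
  rw [laplaceTransform_eq_mgf_neg, iteratedDeriv_comp_neg,
    iteratedDeriv_mgf (Iio_subset_interior_integrableExpSet hX h0 (Set.mem_Iio.2 (neg_lt_zero.2 hs)))]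
  simp

end Laplace

end PLCP

/-! ### The law of the load -/

theorem theorem1 {Ω : Type*} [MeasurableSpace Ω] (P : MeasureTheory.Measure Ω)
    [MeasureTheory.IsProbabilityMeasure P]
    (lb μl lv : ℝ) (hlb : 0 < lb) (hμl : 0 < μl) (hlv : 0 < lv)
    (b : ℕ → Ω → PLCP.Plane) (c : ℕ → Ω → ℝ × ℝ) (T : ℕ → ℕ → Ω → ℝ)
    (hb : PLCP.IsPoissonPointProcess b
      (ENNReal.ofReal lb • (MeasureTheory.volume : MeasureTheory.Measure PLCP.Plane)) P)
    (hc : PLCP.IsPoissonPointProcess c (PLCP.lineIntensity μl) P)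
    (hT : ∀ i, PLCP.IsPoissonPointProcess (T i)
      (ENNReal.ofReal lv • (MeasureTheory.volume : MeasureTheory.Measure ℝ)) P)
    (hbc : ProbabilityTheory.IndepFun (fun ω i => b i ω) (fun ω i => c i ω) P)
    (hTT : ProbabilityTheory.iIndepFun (fun (i : ℕ) (ω : Ω) (j : ℕ) => T i j ω) P)
    (hbcT : ProbabilityTheory.IndepFun (fun ω => ((fun i => b i ω), (fun i => c i ω)))
      (fun ω i j => T i j ω) P)
    (W : Ω → ENNReal)
    (hW : W = fun ω => PLCP.totalChordLength (fun i => b i ω) (fun i => c i ω))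
    (M : Ω → ℕ∞)
    (hM : M = fun ω => PLCP.load (fun i => b i ω) (fun i => c i ω) (fun i j => T i j ω)) :
    -- `W` and `M` are almost surely finite random variables
    Measurable W ∧ Measurable M ∧ (∀ᵐ ω ∂P, W ω < ⊤) ∧ (∀ᵐ ω ∂P, M ω < ⊤) ∧
    -- conditionally on `W`, the load `M` is Poisson with mean `lv * W`
    (∀ m : ℕ, P[Set.indicator {ω | M ω = (m : ℕ∞)} (fun _ => (1 : ℝ)) |
        MeasurableSpace.comap W inferInstance] =ᵐ[P]
      fun ω => Real.exp (-(lv * (W ω).toReal)) * (lv * (W ω).toReal) ^ m / (m.factorial : ℝ)) ∧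
    -- the Laplace transform of `W` is smooth on `(0, ∞)`, and its derivatives give the law of `M`
    ContDiffOn ℝ (⊤ : ℕ∞) (PLCP.laplaceTransform (fun ω => (W ω).toReal) P) (Set.Ioi 0) ∧
    (∀ m : ℕ, P.real {ω | M ω = (m : ℕ∞)} =
      (-lv) ^ m / (m.factorial : ℝ) *
        iteratedDeriv m (PLCP.laplaceTransform (fun ω => (W ω).toReal) P) lv) := by
  have hbm : Measurable fun ω i => b i ω := measurable_pi_lambda _ hb.measurable
  have hcm : Measurable fun ω i => c i ω := measurable_pi_lambda _ hc.measurable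
  have hZm : Measurable fun ω i j => T i j ω :=
    measurable_pi_lambda _ fun i => measurable_pi_lambda _ fun j => (hT i).measurable j
  have hWm : Measurable W := by
    rw [hW]
    exact PLCP.measurable_totalChordLength hbm hcm
  have hMm : Measurable M := by
    rw [hM]
    exact PLCP.measurable_load hbm hcm hZm
  have hWfin : ∀ᵐ ω ∂P, W ω < ⊤ := by
    filter_upwards [PLCP.ae_isLocallyFinite hlb hb hc] with ω hω
    rw [hW]
    exact hω.totalChordLength_ne_top.lt_top
  have hjoint : ∀ {B : Set ENNReal}, MeasurableSet B → ∀ a : ℕ∞, P ({ω | M ω = a} ∩ W ⁻¹' B) =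
      ∫⁻ ω in W ⁻¹' B, (poissonMeasure (ENNReal.ofReal lv * W ω).toNNReal).map
        (Nat.cast : ℕ → ℕ∞) {a} ∂P := by
    intro B hB a
    rw [hW, hM]
    exact PLCP.measure_inter_load_eq hlb hb hc hT hTT hbcT
      (PLCP.measurable_totalChordLength measurable_fst measurable_snd hB) a
  let p : ℕ → ℝ → ℝ := fun m w => Real.exp (-(lv * w)) * (lv * w) ^ m / (m.factorial : ℝ)
  have hp0 : ∀ m ω, 0 ≤ p m (W ω).toReal := fun m ω => by positivity
  have hpm : ∀ m, Measurable fun w : ENNReal => p m w.toReal := fun m => by fun_prop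
  -- This holds even where `W ω = ⊤`: `toNNReal` and `toReal` then both give mean zero.
  have hpo : ∀ (m : ℕ) (ω : Ω), (poissonMeasure (ENNReal.ofReal lv * W ω).toNNReal).map
      (Nat.cast : ℕ → ℕ∞) {(m : ℕ∞)} = ENNReal.ofReal (p m (W ω).toReal) := by
    intro m ω
    have h1 : (Nat.cast : ℕ → ℕ∞) ⁻¹' {(m : ℕ∞)} = {m} := by ext; simp
    rw [Measure.map_apply .of_discrete (measurableSet_singleton _), h1, poissonMeasure_singleton,
      ENNReal.coe_toNNReal_eq_toReal, ENNReal.toReal_mul, ENNReal.toReal_ofReal hlv.le]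
  have hreal : ∀ {B : Set ENNReal}, MeasurableSet B → ∀ m : ℕ,
      P.real ({ω | M ω = (m : ℕ∞)} ∩ W ⁻¹' B) = ∫ ω in W ⁻¹' B, p m (W ω).toReal ∂P := by
    intro B hB m
    rw [measureReal_def, hjoint hB, integral_eq_lintegral_of_nonneg_ae
      (ae_of_all _ (hp0 m)) ((hpm m).comp hWm).aestronglyMeasurable]
    simp only [hpo]
  have hMset : ∀ a : ℕ∞, MeasurableSet {ω | M ω = a} := fun a => hMm (measurableSet_singleton a)
  have hMfin : ∀ᵐ ω ∂P, M ω < ⊤ := by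
    have h := hjoint MeasurableSet.univ ⊤
    have h1 : (Nat.cast : ℕ → ℕ∞) ⁻¹' {⊤} = ∅ := by ext; simp
    simp only [Measure.map_apply Measurable.of_discrete (measurableSet_singleton (⊤ : ℕ∞)), h1,
      measure_empty, lintegral_zero, Set.preimage_univ, Set.inter_univ] at h
    simpa [ae_iff, not_lt, top_le_iff] using h
  have hXm : AEMeasurable (fun ω => (W ω).toReal) P := hWm.ennreal_toReal.aemeasurable
  have hX0 : 0 ≤ fun ω => (W ω).toReal := fun ω => ENNReal.toReal_nonneg
  have hpint : ∀ m, Integrable (fun ω => p m (W ω).toReal) P := by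
    intro m
    refine ⟨((hpm m).comp hWm).aestronglyMeasurable, ?_⟩
    rw [hasFiniteIntegral_iff_ofReal (ae_of_all _ (hp0 m))]
    -- The integral to be bounded is the probability of `M = m`.
    have h := hjoint MeasurableSet.univ (m : ℕ∞)
    simp only [hpo, Set.preimage_univ, Set.inter_univ, Measure.restrict_univ] at h
    rw [← h]
    exact measure_lt_top _ _
  refine ⟨hWm, hMm, hWfin, hMfin, fun m => ?_, PLCP.contDiffOn_laplaceTransform hXm hX0 _,
    fun m => ?_⟩
  · refine (ae_eq_condExp_of_forall_setIntegral_eq hWm.comap_le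
      ((integrable_const _).indicator (hMset _)) (fun _ _ _ => (hpint m).integrableOn) ?_
      ((hpm m).comp (comap_measurable W)).stronglyMeasurable.aestronglyMeasurable).symm
    -- Events of the σ-algebra of `W` are the preimages `W ⁻¹' B`, so `hreal` supplies the defining
    -- identity of the conditional expectation.
    rintro _ ⟨B, hB, rfl⟩ -
    rw [← hreal hB, integral_indicator_const _ (hMset _), measureReal_restrict_apply (hMset _),
      smul_eq_mul, mul_one]
  · have h := hreal MeasurableSet.univ m
    simp only [Set.preimage_univ, Set.inter_univ, Measure.restrict_univ] at h
    rw [h, PLCP.iteratedDeriv_laplaceTransform hXm hX0 hlv, ← mul_assoc, ← integral_const_mul]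
    congr 1 with ω
    -- The sign from differentiation cancels the sign of `(-lv) ^ m`.
    have : (-1 : ℝ) ^ m * (-1) ^ m = 1 := by rw [← mul_pow]; simp
    rw [neg_pow lv]
    simp only [p, mul_pow]
    linear_combination (-(Real.exp (-(lv * (W ω).toReal)) * lv ^ m * (W ω).toReal ^ m /
      (m.factorial : ℝ))) * this
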